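/- Categories are locally small but may be large; "small" refers to sets as opposed to proper classes. A functor $\mathcal{C} \to \mathbf{Set}$ is *small* if it is a small colimit of representables. For a category $\mathcal{A}$, the *conjugate* of a small functor $X \colon \mathcal{A}^{\mathrm{op}} \to \mathbf{Set}$ is the functor $X^\vee \colon \mathcal{A} \to \mathbf{Set}$, $X^\vee(a) = \mathrm{Nat}(X, \mathcal{A}(-,a))$, and the conjugate of a small functor $Y \colon \mathcal{A} \to \mathbf{Set}$ is $Y^\vee \colon \mathcal{A}^{\mathrm{op}} \to \mathbf{Set}$, $Y^\vee(a) = \mathrm{Nat}(Y, \mathcal{A}(a,-))$. A functor $X \colon \mathcal{A}^{\mathrm{op}} \to \mathbf{Set}$ is *reflexive* if $X$ and $X^\vee$ are small and the canonical map $X \to X^{\vee\vee}$, sending $x \in X(a)$ to evaluation at $x$, is an isomorphism. The *reflexive completion* $\mathcal{R}(\mathcal{A})$ is the category of reflexive functors $\mathcal{A}^{\mathrm{op}} \to \mathbf{Set}$ and natural transformations. Representables are reflexive, so there is a Yoneda embedding $J_{\mathcal{A}} \colon \mathcal{A} \to \mathcal{R}(\mathcal{A})$. A functor $F \colon \mathcal{A}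 \to \mathcal{B}$ is *small-adequate* if it is full and faithful, the functors $$\mathcal{B} \to [\mathcal{A}^{\mathrm{op}}, \mathbf{Set}],\ b \mapsto \mathcal{B}(F-, b), \qquad \mathcal{B} \to [\mathcal{A}, \mathbf{Set}]^{\mathrm{op}},\ b \mapsto \mathcal{B}(b, F-)$$ are full and faithful, and for each $b \in \mathcal{B}$ the functors $\mathcal{B}(F-, b)$ and $\mathcal{B}(b, F-)$ are small. In that case $\mathcal{B}(F-, b)$ is reflexive for every $b$, which gives a functor $N_F \colon \mathcal{B} \to \mathcal{R}(\mathcal{A})$, $b \mapsto \mathcal{B}(F-, b)$; moreover $J_{\mathcal{B}} \circ F$ is small-adequate, and one puts $\mathcal{R}(F) = N_{J_{\mathcal{B}} \circ F} \colon \mathcal{R}(\mathcal{B}) \to \mathcal{R}(\mathcal{A})$. **Theorem.** Let $F \colon \mathcal{A} \to \mathcal{B}$ be a small-adequate functor. The following are equivalent: 1. $N_F$ is small-adequate; 2. $\mathcal{R}(F)$ is small-adequate; 3. $\mathcal{R}(F)$ is an equivalence. If these conditions hold then $N_{N_F} \colon \mathcal{R}(\mathcal{A}) \to \mathcal{R}(\mathcal{B})$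 is defined and pseudo-inverse to $\mathcal{R}(F)$, that is, $\mathcal{R}(F) \circ N_{N_F} \cong 1_{\mathcal{R}(\mathcal{A})}$ and $N_{N_F} \circ \mathcal{R}(F) \cong 1_{\mathcal{R}(\mathcal{B})}$. -/

import Mathlib

open CategoryTheory CategoryTheory.Limits Opposite

universe w u u₁ u₂

/-!
Size conventions: "small" means `w`-small. A (locally small, possibly large) category is a type
`C : Type u`, for arbitrary `u`, with hom-sets in `Type w`; `Set` is `Type w`.
-/

namespace Isbell

-- elaborate `X ⟶ Y` through the standard instance path
attribute [local instance 10000] CategoryStruct.toQuiver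

variable {C : Type u} [Category.{w} C]

/-- A functor `C ⥤ Type w` is small if it is a small colimit of representables. Applied to `Cᵒᵖ`,
this also covers functors `Cᵒᵖ ⥤ Type w`. -/
class IsSmall (Z : C ⥤ Type w) : Prop where
  exists_iso_colimit : ∃ (J : Type w) (_ : SmallCategory J) (D : J ⥤ Cᵒᵖ),
    Nonempty (Z ≅ colimit (D ⋙ coyoneda))

lemma IsSmall.of_iso {Z Z' : C ⥤ Type w} (e : Z ≅ Z') [h : IsSmall Z] : IsSmall Z' := by
  obtain ⟨J, _, D, ⟨i⟩⟩ := h.exists_iso_colimit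
  exact ⟨J, _, D, ⟨e.symm ≪≫ i⟩⟩

lemma IsSmall.of_isColimit {J : Type w} [SmallCategory J] {D : J ⥤ Cᵒᵖ}
    {c : Cocone (D ⋙ coyoneda)} (hc : IsColimit c) : IsSmall c.pt :=
  ⟨J, _, D, ⟨hc.coconePointUniqueUpToIso (colimit.isColimit _)⟩⟩

lemma IsSmall.exists_isColimit (Z : C ⥤ Type w) [h : IsSmall Z] :
    ∃ (J : Type w) (_ : SmallCategory J) (D : J ⥤ Cᵒᵖ) (c : Cocone (D ⋙ coyoneda)),
      c.pt = Z ∧ Nonempty (IsColimit c) := by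
  obtain ⟨J, _, D, ⟨i⟩⟩ := h.exists_iso_colimit
  exact ⟨J, _, D, (colimit.cocone _).extend i.inv, rfl,
    ⟨(colimit.isColimit _).extendIso i.inv⟩⟩

lemma nat_apply {Z Y : C ⥤ Type w} (f : Z ⟶ Y) {a b : C} (g : a ⟶ b) (z : Z.obj a) :
    f.app b (Z.map g z) = Y.map g (f.app a z) :=
  NatTrans.naturality_apply f g z

lemma coyoneda_app {c : Cᵒᵖ} {Y : C ⥤ Type w} (f : coyoneda.obj c ⟶ Y) {a : C}
    (x : c.unop ⟶ a) : f.app a x = Y.map x (f.app c.unop (𝟙 c.unop)) := by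
  have := nat_apply f x (𝟙 c.unop)
  simpa using this

lemma coyoneda_hom_ext {c : Cᵒᵖ} {Y : C ⥤ Type w} {f g : coyoneda.obj c ⟶ Y}
    (h : f.app c.unop (𝟙 c.unop) = g.app c.unop (𝟙 c.unop)) : f = g := by
  ext a x
  exact (coyoneda_app f x).trans ((congrArg _ h).trans (coyoneda_app g x).symm)

instance small_hom (Z Y : C ⥤ Type w) [IsSmall Z] : Small.{w} (Z ⟶ Y) := by
  obtain ⟨J, _, D, c, rfl, ⟨hc⟩⟩ := IsSmall.exists_isColimit Z
  refine small_of_injective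
    (f := fun (f : c.pt ⟶ Y) (j : J) ↦ (c.ι.app j ≫ f).app (D.obj j).unop (𝟙 _)) ?_
  intro f g h
  exact hc.hom_ext fun j ↦ coyoneda_hom_ext (congrFun h j)

/-- `Z` is the left Kan extension of its restriction to the full subcategory on `T`,
expressed through the universal property of that extension. -/
def GoodFor (T : Set C) (Z : C ⥤ Type w) : Prop :=
  ∀ (Y : C ⥤ Type w) (φ : ∀ a, a ∈ T → Z.obj a → Y.obj a),
    (∀ (a b : C) (ha : a ∈ T) (hb : b ∈ T) (v : a ⟶ b) (z : Z.obj a),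
      φ b hb (Z.map v z) = Y.map v (φ a ha z)) →
    ∃! f : Z ⟶ Y, ∀ (a : C) (ha : a ∈ T) (z : Z.obj a), f.app a z = φ a ha z

lemma jointly_surjective {J : Type w} [SmallCategory J] {K : J ⥤ C ⥤ Type w} {c : Cocone K}
    (hc : IsColimit c) {a : C} (z : c.pt.obj a) :
    ∃ (j : J) (x : (K.obj j).obj a), (c.ι.app j).app a x = z :=
  Types.jointly_surjective_of_isColimit
    (isColimitOfPreserves ((CategoryTheory.evaluation C (Type w)).obj a) hc) z

lemma cocone_w_apply {J : Type w} [SmallCategory J] {K : J ⥤ C ⥤ Type w} (c : Cocone K)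
    {j j' : J} (u : j ⟶ j') {a : C} (x : (K.obj j).obj a) :
    (c.ι.app j').app a ((K.map u).app a x) = (c.ι.app j).app a x := by
  rw [← c.w u]; rfl

lemma exists_goodFor (Z : C ⥤ Type w) [IsSmall Z] :
    ∃ (S : Set C), Small.{w} S ∧ ∀ T, S ⊆ T → GoodFor T Z := by
  obtain ⟨J, _, D, c, rfl, ⟨hc⟩⟩ := IsSmall.exists_isColimit Z
  refine ⟨Set.range fun j ↦ (D.obj j).unop, inferInstance, fun T hT Y φ hφ ↦ ?_⟩
  have hD : ∀ j, (D.obj j).unop ∈ T := fun j ↦ hT ⟨j, rfl⟩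
  -- the generic element of the leg at `j`
  let e : ∀ j, c.pt.obj (D.obj j).unop := fun j ↦ (c.ι.app j).app _ (𝟙 (D.obj j).unop)
  have he : ∀ (j : J) {a : C} (x : (D.obj j).unop ⟶ a),
      (c.ι.app j).app a x = c.pt.map x (e j) := fun j a x ↦ coyoneda_app (c.ι.app j) x
  have hgen : ∀ {a : C} (z : c.pt.obj a),
      ∃ (j : J) (x : (D.obj j).unop ⟶ a), c.pt.map x (e j) = z := by
    intro a z
    obtain ⟨j, x, rfl⟩ := jointly_surjective hc z
    exact ⟨j, x, (he j x).symm⟩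
  let s : Cocone (D ⋙ coyoneda) :=
    { pt := Y
      ι :=
        { app j := coyonedaEquiv.symm (φ _ (hD j) (e j))
          naturality j j' u := by
            apply coyoneda_hom_ext
            have h1 : c.pt.map (D.map u).unop (e j') = e j := by
              have := cocone_w_apply c u (𝟙 (D.obj j).unop)
              rw [← he]
              simpa [e] using this
            simp [coyonedaEquiv, ← h1]
            exact (hφ _ _ _ _ _ _).symm } }
  have hs : ∀ (j : J) {a : C} (x : (D.obj j).unop ⟶ a),
      (s.ι.app j).app a x = Y.map x (φ _ (hD j) (e j)) := fun j a x ↦ rfl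
  refine ⟨hc.desc s, ?_, ?_⟩
  · intro a ha z
    obtain ⟨j, x, rfl⟩ := hgen z
    rw [hφ _ _ (hD j), ← hs, ← hc.fac s j, ← he]
    rfl
  · intro f hf
    refine hc.uniq s f fun j ↦ coyoneda_hom_ext ?_
    rw [hs]
    simpa using hf _ (hD j) (e j)

lemma isSmall_of_goodFor {Z : C ⥤ Type w} {T : Set C} [Small.{w} T] (h : GoodFor T Z) :
    IsSmall Z := by
  let S : Shrink.{w} T → C := fun t ↦ ((equivShrink T).symm t : C)
  have hS : ∀ t, S t ∈ T := fun t ↦ ((equivShrink T).symm t).2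
  have hid : ∀ t (z : Z.obj (S t)), Z.map (𝟙 (S t)) z = z := by simp
  let i : InducedCategory C S ⥤ C := inducedFunctor S
  let D : (i ⋙ Z).Elementsᵒᵖ ⥤ Cᵒᵖ := (CategoryOfElements.π (i ⋙ Z) ⋙ i).op
  let c : Cocone (D ⋙ coyoneda) :=
    { pt := Z
      ι :=
        { app p := coyonedaEquiv.symm p.unop.2
          naturality p p' u := by
            apply coyoneda_hom_ext
            have h1 : Z.map (D.map u).unop p'.unop.2 = p.unop.2 := u.unop.2
            simp [coyonedaEquiv, h1]
            exact (hid _ p.unop.2).symm } }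
  have key : ∀ s : Cocone (D ⋙ coyoneda), ∃! f : c.pt ⟶ s.pt,
      ∀ p, c.ι.app p ≫ f = s.ι.app p := by
    intro s
    let val : ∀ (t : Shrink.{w} T), Z.obj (S t) → s.pt.obj (S t) :=
      fun t z ↦ (s.ι.app (op ⟨t, z⟩)).app (S t) (𝟙 (S t))
    have hval : ∀ (t t' : Shrink.{w} T) (v : S t ⟶ S t') (z : Z.obj (S t)),
        val t' (Z.map v z) = s.pt.map v (val t z) := by
      intro t t' v z
      let u : ((i ⋙ Z).elementsMk t z) ⟶ ((i ⋙ Z).elementsMk t' (Z.map v z)) :=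
        ⟨InducedCategory.homMk v, rfl⟩
      have h1 := cocone_w_apply s u.op (𝟙 (S t'))
      have h2 := coyoneda_app (s.ι.app (op ⟨t, z⟩)) v
      refine h1.symm.trans (Eq.trans ?_ h2)
      congr 1
      exact Category.comp_id v
    let t₀ : ∀ a ∈ T, Shrink.{w} T := fun a ha ↦ equivShrink T ⟨a, ha⟩
    let e : ∀ a (ha : a ∈ T), S (t₀ a ha) ≅ a := fun a ha ↦ eqToIso (by simp [S, t₀])
    let φ : ∀ a, a ∈ T → Z.obj a → s.pt.obj a := fun a ha z ↦
      s.pt.map (e a ha).hom (val (t₀ a ha) (Z.map (e a ha).inv z))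
    have hφ : ∀ t z, φ (S t) (hS t) z = val t z := by
      intro t z
      simp only [φ, hval]
      simp [← ConcreteCategory.comp_apply, ← Functor.map_comp]
    obtain ⟨f, hf, huniq⟩ := h s.pt φ (by
      intro a b ha hb v z
      have := hval _ _ ((e a ha).hom ≫ v ≫ (e b hb).inv) (Z.map (e a ha).inv z)
      simp only [φ]
      have h1 : Z.map ((e a ha).hom ≫ v ≫ (e b hb).inv) (Z.map (e a ha).inv z) =
          Z.map (e b hb).inv (Z.map v z) := by
        simp [← ConcreteCategory.comp_apply, ← Functor.map_comp]
      rw [← h1, this]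
      simp [← ConcreteCategory.comp_apply, ← Functor.map_comp])
    refine ⟨f, fun p ↦ coyoneda_hom_ext ?_, fun g hg ↦ huniq g fun a ha z ↦ ?_⟩
    · refine Eq.trans ?_ ((hf _ (hS p.unop.1) p.unop.2).trans (hφ _ _))
      exact congrArg (f.app (S p.unop.1)) (hid _ p.unop.2)
    · have h1 : ∀ t z, g.app (S t) z = val t z := by
        intro t z
        simp only [val, ← hg]
        exact (congrArg (g.app (S t)) (hid _ z)).symm
      simp only [φ, ← h1, ← nat_apply]
      simp [← ConcreteCategory.comp_apply]
  exact IsSmall.of_isColimit (c := c)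
    { desc s := (key s).choose
      fac s := (key s).choose_spec.1
      uniq s f hf := (key s).choose_spec.2 f hf }

/-- A small colimit of small functors is small. -/
lemma isSmall_pt_of_isColimit {J : Type w} [SmallCategory J] {K : J ⥤ C ⥤ Type w}
    {c : Cocone K} (hc : IsColimit c) (hK : ∀ j, IsSmall (K.obj j)) : IsSmall c.pt := by
  choose S hS hS' using fun j ↦ exists_goodFor (K.obj j)
  have : Small.{w} (⋃ j, S j : Set C) := inferInstance
  refine isSmall_of_goodFor (T := ⋃ j, S j) fun Y φ hφ ↦ ?_
  have key : ∀ j, ∃! f : K.obj j ⟶ Y, ∀ a ha (z : (K.obj j).obj a),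
      f.app a z = φ a ha ((c.ι.app j).app a z) := fun j ↦
    hS' j _ (Set.subset_iUnion S j) Y (fun a ha z ↦ φ a ha ((c.ι.app j).app a z))
      fun a b ha hb v z ↦
        (congrArg (φ b hb) (nat_apply (Y := c.pt) (c.ι.app j) v z)).trans (hφ a b ha hb v _)
  choose f hf huniq using key
  let s : Cocone K :=
    { pt := Y
      ι :=
        { app := f
          naturality j j' u := by
            exact (huniq j (K.map u ≫ f j') fun a ha z ↦ by
              rw [← cocone_w_apply c u, ← hf j' a ha]
              rfl).trans (Category.comp_id _).symm } }
  refine ⟨hc.desc s, fun a ha z ↦ ?_, fun g hg ↦ ?_⟩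
  · obtain ⟨j, x, rfl⟩ := jointly_surjective hc z
    rw [← hf j a ha, show f j = c.ι.app j ≫ hc.desc s from (hc.fac s j).symm]
    rfl
  · refine hc.uniq s g fun j ↦ huniq j _ fun a ha z ↦ ?_
    rw [← hg a ha]
    rfl

/-- Restriction along a functor `G` preserves smallness if the functors `D(d, G-)` are small. -/
lemma IsSmall.comp {C' : Type u₁} [Category.{w} C'] (G : C' ⥤ C)
    (hG : ∀ d : Cᵒᵖ, IsSmall (G ⋙ coyoneda.obj d)) (Z : C ⥤ Type w) [IsSmall Z] :
    IsSmall (G ⋙ Z) := by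
  obtain ⟨J, _, D, c, rfl, ⟨hc⟩⟩ := IsSmall.exists_isColimit Z
  exact isSmall_pt_of_isColimit
    (isColimitOfPreserves ((Functor.whiskeringLeft C' C (Type w)).obj G) hc) fun j ↦ hG (D.obj j)

lemma isSmall_coyoneda (c : Cᵒᵖ) : IsSmall (coyoneda.obj c) := by
  refine isSmall_of_goodFor (T := {c.unop}) fun Y φ hφ ↦ ?_
  refine ⟨coyonedaEquiv.symm (φ c.unop rfl (𝟙 c.unop)), ?_, fun f hf ↦ ?_⟩
  · rintro a ha z
    obtain rfl : a = c.unop := ha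
    have := hφ c.unop c.unop rfl rfl z (𝟙 c.unop)
    simp at this
    exact this.symm
  · apply coyoneda_hom_ext
    simpa [coyonedaEquiv] using hf _ rfl (𝟙 c.unop)

lemma isSmall_yoneda (c : C) : IsSmall (yoneda.obj c) :=
  @IsSmall.of_iso _ _ _ _
    (NatIso.ofComponents (fun a ↦ (opEquiv (op c) a).toIso) : coyoneda.obj (op (op c)) ≅ _)
    (isSmall_coyoneda (op (op c)))

/-- The conjugate of a small functor `X : Cᵒᵖ ⥤ Type w`: the functor sending `a` to
the `w`-small set of natural transformations `X ⟶ C(-, a)`. -/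
noncomputable def conj (X : Cᵒᵖ ⥤ Type w) [IsSmall X] : C ⥤ Type w where
  obj a := Shrink.{w} (X ⟶ yoneda.obj a)
  map f := ↾fun ξ ↦ equivShrink _ ((equivShrink _).symm ξ ≫ yoneda.map f)

/-- The conjugate of a small functor `Y : C ⥤ Type w`: the functor sending `a` to
the `w`-small set of natural transformations `Y ⟶ C(a, -)`. -/
noncomputable def coconj (Y : C ⥤ Type w) [IsSmall Y] : Cᵒᵖ ⥤ Type w where
  obj a := Shrink.{w} (Y ⟶ coyoneda.obj a)
  map f := ↾fun ζ ↦ equivShrink _ ((equivShrink _).symm ζ ≫ coyoneda.map f)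

/-- Elements of `(conj X).obj b` are natural transformations `X ⟶ C(-, b)`. -/
noncomputable def conjEquiv (X : Cᵒᵖ ⥤ Type w) [IsSmall X] (b : C) :
    (conj X).obj b ≃ (X ⟶ yoneda.obj b) :=
  (equivShrink _).symm

/-- Elements of `(coconj Y).obj a` are natural transformations `Y ⟶ C(a, -)`. -/
noncomputable def coconjEquiv (Y : C ⥤ Type w) [IsSmall Y] (a : Cᵒᵖ) :
    (coconj Y).obj a ≃ (Y ⟶ coyoneda.obj a) :=
  (equivShrink _).symm

lemma conjEquiv_map (X : Cᵒᵖ ⥤ Type w) [IsSmall X] {b b' : C} (g : b ⟶ b')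
    (ξ : (conj X).obj b) :
    conjEquiv X b' ((conj X).map g ξ) = conjEquiv X b ξ ≫ yoneda.map g :=
  (equivShrink _).symm_apply_apply _

lemma coconjEquiv_map (Y : C ⥤ Type w) [IsSmall Y] {a a' : Cᵒᵖ} (f : a ⟶ a')
    (ζ : (coconj Y).obj a) :
    coconjEquiv Y a' ((coconj Y).map f ζ) = coconjEquiv Y a ζ ≫ coyoneda.map f :=
  (equivShrink _).symm_apply_apply _

/-- Evaluation at `x : X(a)`, as a natural transformation from the conjugate of `X`
to `C(a, -)`. -/
noncomputable def evalAt (X : Cᵒᵖ ⥤ Type w) [IsSmall X] {a : Cᵒᵖ} (x : X.obj a) :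
    conj X ⟶ coyoneda.obj a where
  app b := ↾fun ξ ↦ (conjEquiv X b ξ).app a x
  naturality b b' f := by
    refine ConcreteCategory.hom_ext _ _ fun ξ ↦ ?_
    change (conjEquiv X b' ((conj X).map f ξ)).app a x = _
    rw [conjEquiv_map]
    rfl

/-- The canonical map `η` from `X` to its double conjugate, sending `x : X(a)` to
evaluation at `x`. -/
noncomputable def unit (X : Cᵒᵖ ⥤ Type w) [IsSmall X] [IsSmall (conj X)] :
    X ⟶ coconj (conj X) where
  app a := ↾fun x ↦ (coconjEquiv (conj X) a).symm (evalAt X x)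
  naturality a a' f := by
    refine ConcreteCategory.hom_ext _ _ fun x ↦ ?_
    apply (coconjEquiv (conj X) a').injective
    change coconjEquiv _ _ ((coconjEquiv _ _).symm _) =
      coconjEquiv _ _ ((coconj _).map f ((coconjEquiv _ _).symm _))
    rw [coconjEquiv_map, Equiv.apply_symm_apply, Equiv.apply_symm_apply]
    ext b ξ
    exact nat_apply (conjEquiv X b ξ) f x

/-- A functor `X : Cᵒᵖ ⥤ Type w` is reflexive if it is small with small conjugate and the
canonical map to its double conjugate is an isomorphism. -/
def IsReflexive (X : Cᵒᵖ ⥤ Type w) : Prop :=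
  ∃ (_ : IsSmall X) (_ : IsSmall (conj X)), IsIso (unit X)

instance locallySmall_reflexive (A : Type u) [Category.{w} A] :
    LocallySmall.{w} (ObjectProperty.FullSubcategory (IsReflexive (C := A))) where
  hom_small X Y :=
    have : IsSmall X.obj := X.property.choose
    small_of_injective (f := fun f : X ⟶ Y ↦ f.hom) fun _ _ h ↦ ObjectProperty.hom_ext _ h

/-- The reflexive completion of `A`: the category of reflexive functors `Aᵒᵖ ⥤ Type w` and all
natural transformations between them (its hom-sets, being `w`-small, are replaced by
isomorphic copies in `Type w`). -/
def ReflexiveCompletion (A : Type u) [Category.{w} A] : Type (max u (w + 1)) :=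
  ShrinkHoms (ObjectProperty.FullSubcategory (IsReflexive (C := A)))

noncomputable instance (A : Type u) [Category.{w} A] : Category.{w} (ReflexiveCompletion A) :=
  inferInstanceAs (Category.{w} (ShrinkHoms (ObjectProperty.FullSubcategory (IsReflexive (C := A)))))

/-- A natural pairing `X(a) × Y(b) → C(a, b)` exhibiting each of `X` and `Y` as
the conjugate of the other. -/
structure ConjPair (X : Cᵒᵖ ⥤ Type w) (Y : C ⥤ Type w) where
  p : ∀ {a b : C}, X.obj (op a) → Y.obj b → (a ⟶ b)
  p_left : ∀ {a a' b : C} (f : a' ⟶ a) (x : X.obj (op a)) (y : Y.obj b),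
    p (X.map f.op x) y = f ≫ p x y
  p_right : ∀ {a b b' : C} (g : b ⟶ b') (x : X.obj (op a)) (y : Y.obj b),
    p x (Y.map g y) = p x y ≫ g
  right : ∀ (b : C) (ξ : X ⟶ yoneda.obj b), ∃! y : Y.obj b, ∀ (a : C) (x : X.obj (op a)),
    ξ.app (op a) x = p x y
  left : ∀ (a : C) (ζ : Y ⟶ coyoneda.obj (op a)), ∃! x : X.obj (op a), ∀ (b : C) (y : Y.obj b),
    ζ.app b y = p x y

namespace ConjPair

variable {X : Cᵒᵖ ⥤ Type w} {Y : C ⥤ Type w}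

/-- The transformation `X ⟶ C(-, b)` given by pairing with `y`. -/
def toRight (P : ConjPair X Y) {b : C} (y : Y.obj b) : X ⟶ yoneda.obj b where
  app a := ↾fun x ↦ P.p (a := a.unop) x y
  naturality _ _ f := ConcreteCategory.hom_ext _ _ fun x ↦ P.p_left f.unop x y

/-- The transformation `Y ⟶ C(a, -)` given by pairing with `x`. -/
def toLeft (P : ConjPair X Y) {a : Cᵒᵖ} (x : X.obj a) : Y ⟶ coyoneda.obj a where
  app _ := ↾fun y ↦ P.p (a := a.unop) x y
  naturality _ _ f := ConcreteCategory.hom_ext _ _ fun y ↦ P.p_right f x y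

lemma bijective_toRight (P : ConjPair X Y) (b : C) : Function.Bijective (P.toRight (b := b)) := by
  refine (Function.bijective_iff_existsUnique _).2 fun ξ ↦ ?_
  obtain ⟨y, hy, huniq⟩ := P.right b ξ
  refine ⟨y, ?_, fun y' hy' ↦ huniq y' fun a x ↦ ?_⟩
  · ext a x
    exact (hy a.unop x).symm
  · rw [← hy']; rfl

lemma bijective_toLeft (P : ConjPair X Y) (a : Cᵒᵖ) : Function.Bijective (P.toLeft (a := a)) := by
  refine (Function.bijective_iff_existsUnique _).2 fun ζ ↦ ?_
  obtain ⟨x, hx, huniq⟩ := P.left a.unop ζ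
  refine ⟨x, ?_, fun x' hx' ↦ huniq x' fun b y ↦ ?_⟩
  · ext b y
    exact (hx b y).symm
  · rw [← hx']; rfl

/-- `Y` is isomorphic to the conjugate of `X`. -/
noncomputable def conjIso (P : ConjPair X Y) [IsSmall X] : Y ≅ conj X :=
  NatIso.ofComponents
    (fun b ↦ ((Equiv.ofBijective _ (P.bijective_toRight b)).trans (conjEquiv X b).symm).toIso)
    fun {b b'} g ↦ by
      refine ConcreteCategory.hom_ext _ _ fun y ↦ (conjEquiv X b').injective ?_
      change conjEquiv X b' ((conjEquiv X b').symm (P.toRight (Y.map g y))) =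
        conjEquiv X b' ((conj X).map g ((conjEquiv X b).symm (P.toRight y)))
      rw [conjEquiv_map, Equiv.apply_symm_apply, Equiv.apply_symm_apply]
      ext a x
      exact P.p_right g x y

lemma isReflexive (P : ConjPair X Y) [IsSmall X] [IsSmall Y] : IsReflexive X := by
  have : IsSmall (conj X) := IsSmall.of_iso P.conjIso
  refine ⟨inferInstance, this, ?_⟩
  have (a : Cᵒᵖ) : IsIso ((unit X).app a) := by
    rw [isIso_iff_bijective]
    have h : ⇑(ConcreteCategory.hom ((unit X).app a)) =
        (coconjEquiv (conj X) a).symm ∘ (P.conjIso.homFromEquiv (Z := coyoneda.obj a)) ∘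
          P.toLeft := by
      funext x
      refine congrArg (coconjEquiv (conj X) a).symm ?_
      change _ = P.conjIso.inv ≫ P.toLeft x
      rw [Iso.eq_inv_comp]
      ext b y
      change (conjEquiv X b ((conjEquiv X b).symm (P.toRight y))).app a x = _
      rw [Equiv.apply_symm_apply]
      rfl
    rw [h]
    exact (coconjEquiv (conj X) a).symm.bijective.comp
      ((Equiv.bijective _).comp (P.bijective_toLeft a))
  exact NatIso.isIso_of_isIso_app _

end ConjPair

lemma IsReflexive.exists_conjPair {X : Cᵒᵖ ⥤ Type w} (h : IsReflexive X) :
    ∃ Y : C ⥤ Type w, IsSmall Y ∧ Nonempty (ConjPair X Y) := by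
  obtain ⟨_, h', h''⟩ := h
  refine ⟨conj X, h', ⟨
    { p {a b} x y := (conjEquiv X b y).app (op a) x
      p_left f x y := nat_apply (conjEquiv X _ y) f.op x
      p_right g x y := by rw [conjEquiv_map]; rfl
      right b ξ := ?_
      left a ζ := ?_ }⟩⟩
  · refine ⟨(conjEquiv X b).symm ξ, fun a x ↦ by rw [Equiv.apply_symm_apply], fun y hy ↦ ?_⟩
    refine (Equiv.eq_symm_apply _).2 ?_
    ext a x
    exact (hy a.unop x).symm
  · have hb : Function.Bijective ((unit X).app (op a)) :=
      (isIso_iff_bijective _).1 inferInstance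
    obtain ⟨x, hx, huniq⟩ := hb.existsUnique ((coconjEquiv (conj X) (op a)).symm ζ)
    refine ⟨x, fun b y ↦ ?_, fun x' hx' ↦ huniq x' ?_⟩
    · rw [(coconjEquiv (conj X) (op a)).symm.injective hx.symm]
      rfl
    · refine congrArg (coconjEquiv (conj X) (op a)).symm ?_
      ext b y
      exact (hx' b y).symm

section Functors

variable {A : Type u₁} [Category.{w} A] {B : Type u₂} [Category.{w} B]

/-- The nerve functor of `F : A ⥤ B`, sending `b` to `B(F-, b) : Aᵒᵖ ⥤ Type w`. -/
def nerve (F : A ⥤ B) : B ⥤ Aᵒᵖ ⥤ Type w :=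
  yoneda ⋙ (Functor.whiskeringLeft Aᵒᵖ Bᵒᵖ (Type w)).obj F.op

/-- The conerve functor of `F : A ⥤ B`, sending `b` to `B(b, F-) : A ⥤ Type w`. -/
def conerve (F : A ⥤ B) : B ⥤ (A ⥤ Type w)ᵒᵖ :=
  (coyoneda ⋙ (Functor.whiskeringLeft A B (Type w)).obj F).rightOp

/-- `F` is dense if its nerve functor is full and faithful. -/
structure IsDense (F : A ⥤ B) : Prop where
  full : (nerve F).Full
  faithful : (nerve F).Faithful

/-- `F` is codense if its conerve functor is full and faithful. -/
structure IsCodense (F : A ⥤ B) : Prop where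
  full : (conerve F).Full
  faithful : (conerve F).Faithful

/-- `F` is representably small if each functor `B(F-, b)` is small. -/
def IsRepresentablySmall (F : A ⥤ B) : Prop :=
  ∀ b : B, IsSmall ((nerve F).obj b)

/-- `F` is corepresentably small if each functor `B(b, F-)` is small. -/
def IsCorepresentablySmall (F : A ⥤ B) : Prop :=
  ∀ b : B, IsSmall ((conerve F).obj b).unop

/-- `F` is small-adequate if it is full, faithful, small-dense (dense and representably small)
and small-codense (codense and corepresentably small). -/
structure IsSmallAdequate (F : A ⥤ B) : Prop where
  full : F.Full
  faithful : F.Faithful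
  dense : IsDense F
  representablySmall : IsRepresentablySmall F
  codense : IsCodense F
  corepresentablySmall : IsCorepresentablySmall F

lemma IsDense.existsUnique {F : A ⥤ B} (h : IsDense F) {b b' : B}
    (ψ : ∀ a, (F.obj a ⟶ b) → (F.obj a ⟶ b'))
    (hψ : ∀ (a a' : A) (f : a' ⟶ a) (v : F.obj a ⟶ b), ψ a' (F.map f ≫ v) = F.map f ≫ ψ a v) :
    ∃! m : b ⟶ b', ∀ (a : A) (v : F.obj a ⟶ b), v ≫ m = ψ a v := by
  have := h.full
  have := h.faithful
  let θ : (nerve F).obj b ⟶ (nerve F).obj b' :=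
    { app a := ↾fun v ↦ ψ a.unop v
      naturality a a' f := ConcreteCategory.hom_ext _ _ fun v ↦ hψ a.unop a'.unop f.unop v }
  refine ⟨(nerve F).preimage θ, fun a v ↦ ?_, fun m hm ↦ (nerve F).map_injective ?_⟩
  · exact ConcreteCategory.congr_hom (CC := fun X ↦ X)
      (NatTrans.congr_app ((nerve F).map_preimage θ) (op a)) v
  · rw [(nerve F).map_preimage]
    ext a v
    exact hm a.unop v

lemma IsCodense.existsUnique {F : A ⥤ B} (h : IsCodense F) {b b' : B}
    (ψ : ∀ a, (b' ⟶ F.obj a) → (b ⟶ F.obj a))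
    (hψ : ∀ (a a' : A) (f : a ⟶ a') (v : b' ⟶ F.obj a), ψ a' (v ≫ F.map f) = ψ a v ≫ F.map f) :
    ∃! m : b ⟶ b', ∀ (a : A) (v : b' ⟶ F.obj a), m ≫ v = ψ a v := by
  have := h.full
  have := h.faithful
  let θ : ((conerve F).obj b').unop ⟶ ((conerve F).obj b).unop :=
    { app a := ↾fun v ↦ ψ a v
      naturality a a' f := ConcreteCategory.hom_ext _ _ fun v ↦ hψ a a' f v }
  refine ⟨(conerve F).preimage θ.op, fun a v ↦ ?_, fun m hm ↦ (conerve F).map_injective ?_⟩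
  · exact ConcreteCategory.congr_hom (CC := fun X ↦ X)
      (NatTrans.congr_app (congrArg Quiver.Hom.unop ((conerve F).map_preimage θ.op)) a) v
  · rw [(conerve F).map_preimage]
    apply Quiver.Hom.unop_inj
    ext a v
    exact hm a v

/-- If `F` is small-adequate, then the functors `B(F-, b)` and `B(b, F-)` are conjugate. -/
noncomputable def IsSmallAdequate.conjPair {F : A ⥤ B} (h : IsSmallAdequate F) (b : B) :
    ConjPair ((nerve F).obj b) ((conerve F).obj b).unop :=
  have := h.full
  have := h.faithful
  { p {a a'} (x : F.obj a ⟶ b) (y : b ⟶ F.obj a') := F.preimage (x ≫ y)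
    p_left {a a' _} f (x : F.obj a ⟶ b) y := F.map_injective (by
      change F.map (F.preimage ((F.map f ≫ x) ≫ y)) = _
      rw [F.map_preimage, F.map_comp, F.map_preimage]
      exact Category.assoc _ _ _)
    p_right {a b' _} g x (y : b ⟶ F.obj b') := F.map_injective (by
      change F.map (F.preimage (x ≫ (y ≫ F.map g))) = _
      rw [F.map_preimage, F.map_comp, F.map_preimage]
      exact (Category.assoc _ _ _).symm)
    right a' ξ := by
      obtain ⟨m, hm, huniq⟩ := h.dense.existsUnique (b := b) (b' := F.obj a')
        (fun a v ↦ F.map (ξ.app (op a) v)) (fun a a'' f v ↦ by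
          rw [← F.map_comp]
          exact congrArg F.map (nat_apply ξ f.op v))
      refine ⟨m, fun a x ↦ F.map_injective ?_, fun y hy ↦ huniq y fun a v ↦ ?_⟩
      · rw [F.map_preimage]
        exact (hm a x).symm
      · exact ((congrArg F.map (hy a v)).trans (F.map_preimage _)).symm
    left a ζ := by
      obtain ⟨m, hm, huniq⟩ := h.codense.existsUnique (b := F.obj a) (b' := b)
        (fun a' v ↦ F.map (ζ.app a' v)) (fun a' a'' f v ↦ by
          rw [← F.map_comp]
          exact congrArg F.map (nat_apply ζ f v))
      refine ⟨m, fun a' y ↦ F.map_injective ?_, fun x hx ↦ huniq x fun a' v ↦ ?_⟩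
      · rw [F.map_preimage]
        exact (hm a' y).symm
      · exact ((congrArg F.map (hx a' v)).trans (F.map_preimage _)).symm }

lemma IsSmallAdequate.isReflexive_nerve {F : A ⥤ B} (h : IsSmallAdequate F) (b : B) :
    IsReflexive ((nerve F).obj b) :=
  have := h.representablySmall b
  have := h.corepresentablySmall b
  (h.conjPair b).isReflexive

lemma isReflexive_yoneda (a : A) : IsReflexive (yoneda.obj a) := by
  have := isSmall_yoneda a
  have := isSmall_coyoneda (op a)
  let P : ConjPair (yoneda.obj a) (coyoneda.obj (op a)) :=
    { p x y := x ≫ y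
      p_left f x y := Category.assoc f x y
      p_right g x y := (Category.assoc x y g).symm
      right b ξ := by
        refine ⟨ξ.app (op a) (𝟙 a), fun c x ↦ ?_, fun y hy ↦ ?_⟩
        · have := nat_apply ξ (Quiver.Hom.op x) (𝟙 a)
          simpa using this
        · simpa using (hy a (𝟙 a)).symm
      left b ζ := by
        refine ⟨ζ.app a (𝟙 a), fun c y ↦ ?_, fun x hx ↦ ?_⟩
        · have := nat_apply ζ y (𝟙 a)
          simpa using this
        · simpa using (hx a (𝟙 a)).symm }
  exact P.isReflexive

/-- The Yoneda embedding `J : A ⥤ R(A)` into the reflexive completion. -/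
noncomputable def yonedaR (A : Type u₁) [Category.{w} A] : A ⥤ ReflexiveCompletion A :=
  ObjectProperty.lift _ yoneda isReflexive_yoneda ⋙ ShrinkHoms.functor _

/-- For small-adequate `F : A ⥤ B`, the functor `N_F : B ⥤ R(A)`, sending `b` to the
reflexive functor `B(F-, b)`. -/
noncomputable def nerveR (F : A ⥤ B) (h : IsSmallAdequate F) : B ⥤ ReflexiveCompletion A :=
  ObjectProperty.lift _ (nerve F) h.isReflexive_nerve ⋙ ShrinkHoms.functor _

/-- The inclusion of `R(A)` into the category of all functors `Aᵒᵖ ⥤ Type w`. -/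
noncomputable def inclR (A : Type u₁) [Category.{w} A] : ReflexiveCompletion A ⥤ Aᵒᵖ ⥤ Type w :=
  ShrinkHoms.inverse _ ⋙ ObjectProperty.ι _

instance : (inclR A).Full :=
  Functor.Full.comp (ShrinkHoms.inverse.{w} _) (ObjectProperty.ι _)

instance : (inclR A).Faithful :=
  Functor.Faithful.comp (ShrinkHoms.inverse.{w} _) (ObjectProperty.ι _)

instance : (yonedaR A).Full :=
  Functor.Full.comp (ObjectProperty.lift _ yoneda isReflexive_yoneda) (ShrinkHoms.functor.{w} _)

instance : (yonedaR A).Faithful :=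
  Functor.Faithful.comp (ObjectProperty.lift _ yoneda isReflexive_yoneda)
    (ShrinkHoms.functor.{w} _)

lemma isReflexive_inclR (Z : ReflexiveCompletion A) : IsReflexive ((inclR A).obj Z) :=
  (ShrinkHoms.fromShrinkHoms Z).property

lemma inclR_map_yonedaR {a a' : A} (f : a ⟶ a') :
    (inclR A).map ((yonedaR A).map f) = yoneda.map f :=
  congrArg InducedCategory.Hom.hom ((equivShrink _).symm_apply_apply
    ((ObjectProperty.lift _ yoneda isReflexive_yoneda).map f))

/-- The Yoneda lemma in the reflexive completion. -/
noncomputable def yonedaREquiv (a : A) (Z : ReflexiveCompletion A) :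
    ((yonedaR A).obj a ⟶ Z) ≃ ((inclR A).obj Z).obj (op a) :=
  (Functor.FullyFaithful.ofFullyFaithful (inclR A)).homEquiv.trans
    (yonedaEquiv (X := a) (F := (inclR A).obj Z))

lemma yonedaREquiv_map_comp {a a' : A} (f : a' ⟶ a) {Z : ReflexiveCompletion A}
    (g : (yonedaR A).obj a ⟶ Z) :
    yonedaREquiv a' Z ((yonedaR A).map f ≫ g) =
      ((inclR A).obj Z).map f.op (yonedaREquiv a Z g) := by
  change yonedaEquiv (X := a') (F := (inclR A).obj Z) ((inclR A).map (X := (yonedaR A).obj a') _) = ((inclR A).obj Z).map f.op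
    (yonedaEquiv (X := a) (F := (inclR A).obj Z) ((inclR A).map (X := (yonedaR A).obj a) g))
  rw [Functor.map_comp, inclR_map_yonedaR]
  exact (yonedaEquiv_naturality (F := (inclR A).obj Z)
    ((inclR A).map (X := (yonedaR A).obj a) g) f).symm

lemma yonedaREquiv_comp {a : A} {Z Z' : ReflexiveCompletion A}
    (g : (yonedaR A).obj a ⟶ Z) (θ : Z ⟶ Z') :
    yonedaREquiv a Z' (g ≫ θ) = ((inclR A).map θ).app (op a) (yonedaREquiv a Z g) := by
  change yonedaEquiv (X := a) (F := (inclR A).obj Z') ((inclR A).map (X := (yonedaR A).obj a) _) = _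
  rw [Functor.map_comp]
  rfl

/-- Maps in the reflexive completion into a representable are maps of functors. -/
noncomputable def homYonedaREquiv (Z : ReflexiveCompletion A) (a : A) :
    (Z ⟶ (yonedaR A).obj a) ≃ ((inclR A).obj Z ⟶ yoneda.obj a) :=
  (Functor.FullyFaithful.ofFullyFaithful (inclR A)).homEquiv

lemma homYonedaREquiv_comp {Z Z' : ReflexiveCompletion A} {a : A} (θ : Z ⟶ Z')
    (g : Z' ⟶ (yonedaR A).obj a) :
    homYonedaREquiv Z a (θ ≫ g) = (inclR A).map θ ≫ homYonedaREquiv Z' a g :=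
  (inclR A).map_comp θ g

lemma homYonedaREquiv_comp_map {Z : ReflexiveCompletion A} {a a' : A}
    (g : Z ⟶ (yonedaR A).obj a) (f : a ⟶ a') :
    homYonedaREquiv Z a' (g ≫ (yonedaR A).map f) = homYonedaREquiv Z a g ≫ yoneda.map f :=
  ((inclR A).map_comp g _).trans
    (congrArg ((homYonedaREquiv Z a g) ≫ ·) (inclR_map_yonedaR f))

lemma isDense_of_existsUnique {F : A ⥤ B} (h : ∀ {b b' : B}
    (ψ : ∀ a, (F.obj a ⟶ b) → (F.obj a ⟶ b')),
    (∀ (a a' : A) (f : a' ⟶ a) (v : F.obj a ⟶ b), ψ a' (F.map f ≫ v) = F.map f ≫ ψ a v) →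
    ∃! m : b ⟶ b', ∀ (a : A) (v : F.obj a ⟶ b), v ≫ m = ψ a v) : IsDense F where
  full := ⟨fun {b b'} θ ↦ by
    obtain ⟨m, hm, -⟩ := h (b := b) (b' := b') (fun a v ↦ θ.app (op a) v)
      fun a a' f v ↦ nat_apply θ f.op v
    refine ⟨m, ?_⟩
    ext a v
    exact hm a.unop v⟩
  faithful := ⟨fun {b b'} m m' hmm ↦ by
    refine (h (fun a v ↦ v ≫ m) fun a a' f v ↦ Category.assoc _ _ _).unique
      (fun a v ↦ rfl) fun a v ↦ ?_
    exact (ConcreteCategory.congr_hom (CC := fun X ↦ X)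
      (NatTrans.congr_app hmm (op a)) v).symm⟩

lemma isCodense_of_existsUnique {F : A ⥤ B} (h : ∀ {b b' : B}
    (ψ : ∀ a, (b' ⟶ F.obj a) → (b ⟶ F.obj a)),
    (∀ (a a' : A) (f : a ⟶ a') (v : b' ⟶ F.obj a), ψ a' (v ≫ F.map f) = ψ a v ≫ F.map f) →
    ∃! m : b ⟶ b', ∀ (a : A) (v : b' ⟶ F.obj a), m ≫ v = ψ a v) : IsCodense F where
  full := ⟨fun {b b'} θ ↦ by
    obtain ⟨m, hm, -⟩ := h (b := b) (b' := b') (fun a v ↦ θ.unop.app a v)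
      fun a a' f v ↦ nat_apply θ.unop f v
    refine ⟨m, Quiver.Hom.unop_inj ?_⟩
    ext a v
    exact hm a v⟩
  faithful := ⟨fun {b b'} m m' hmm ↦ by
    refine (h (fun a v ↦ m ≫ v) fun a a' f v ↦ (Category.assoc _ _ _).symm).unique
      (fun a v ↦ rfl) fun a v ↦ ?_
    exact (ConcreteCategory.congr_hom (CC := fun X ↦ X)
      (NatTrans.congr_app (congrArg Quiver.Hom.unop hmm) a) v).symm⟩

/-- A family of elements natural in `y` and `x` determines a transformation into `X'`. -/
lemma ConjPair.exists_hom {X X' : Bᵒᵖ ⥤ Type w} {Y' : B ⥤ Type w} (P : ConjPair X' Y')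
    (m : ∀ {b b' : B}, X.obj (op b) → Y'.obj b' → (b ⟶ b'))
    (h₁ : ∀ {b c b' : B} (f : c ⟶ b) (x : X.obj (op b)) (y : Y'.obj b'),
      m (X.map f.op x) y = f ≫ m x y)
    (h₂ : ∀ {b b' c : B} (g : b' ⟶ c) (x : X.obj (op b)) (y : Y'.obj b'),
      m x (Y'.map g y) = m x y ≫ g) :
    ∃ θ : X ⟶ X', ∀ {b b' : B} (x : X.obj (op b)) (y : Y'.obj b'),
      P.p (θ.app (op b) x) y = m x y := by
  let ζ : ∀ {b : B}, X.obj (op b) → (Y' ⟶ coyoneda.obj (op b)) := fun {b} x ↦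
    { app b' := ↾fun y ↦ m x y
      naturality b' c g := ConcreteCategory.hom_ext _ _ fun y ↦ h₂ g x y }
  choose t ht hu using fun (b : B) (x : X.obj (op b)) ↦ P.left b (ζ x)
  refine ⟨
    { app b := ↾fun x ↦ t b.unop x
      naturality b c f := ConcreteCategory.hom_ext _ _ fun x ↦ ?_ }, fun x y ↦ (ht _ x _ y).symm⟩
  refine (hu c.unop (X.map f x) (X'.map f (t b.unop x)) fun b' y ↦ ?_).symm
  refine (h₁ f.unop x y).trans ?_
  refine Eq.trans ?_ (P.p_left f.unop _ y).symm
  exact congrArg (f.unop ≫ ·) (ht _ x _ y)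

lemma ConjPair.hom_ext {X' : Bᵒᵖ ⥤ Type w} {Y' : B ⥤ Type w} (P : ConjPair X' Y')
    {b : B} {x x' : X'.obj (op b)} (h : ∀ (b' : B) (y : Y'.obj b'), P.p x y = P.p x' y) :
    x = x' :=
  (P.bijective_toLeft (op b)).injective (by ext b' y; exact h b' y)

lemma IsDense.extend {F : A ⥤ B} (h : IsDense F) {X X' : Bᵒᵖ ⥤ Type w} {Y' : B ⥤ Type w}
    (P : ConjPair X' Y') (φ : ∀ a : A, X.obj (op (F.obj a)) → X'.obj (op (F.obj a)))
    (hφ : ∀ {a a' : A} (f : a' ⟶ a) (x : X.obj (op (F.obj a))),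
      φ a' (X.map (F.map f).op x) = X'.map (F.map f).op (φ a x)) :
    ∃! θ : X ⟶ X', ∀ (a : A) (x : X.obj (op (F.obj a))), θ.app (op (F.obj a)) x = φ a x := by
  choose m hm hu using fun (b b' : B) (x : X.obj (op b)) (y : Y'.obj b') ↦
    h.existsUnique (b := b) (b' := b') (fun a v ↦ P.p (φ a (X.map v.op x)) y) (fun a a' f v ↦ by
      rw [← P.p_left, ← hφ]
      simp)
  obtain ⟨θ, hθ⟩ := P.exists_hom (X := X) (fun {b b'} x y ↦ m b b' x y)
    (fun {b c b'} f x y ↦ (hu c b' _ y _ fun a v ↦ by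
      have := hm b b' x y a (v ≫ f)
      simpa using this).symm)
    (fun {b b' c} g x y ↦ (hu b c x _ _ fun a v ↦ by
      rw [← Category.assoc, hm, P.p_right]).symm)
  refine ⟨θ, fun a x ↦ P.hom_ext fun b' y ↦ ?_, fun θ' hθ' ↦ ?_⟩
  · rw [hθ]
    have := hm _ _ x y a (𝟙 _)
    simpa using this
  · ext b x
    refine P.hom_ext (b := b.unop) fun b' y ↦ ?_
    refine Eq.trans ?_ (hθ x y).symm
    refine hu _ _ x y _ fun a v ↦ ?_
    rw [← P.p_left, ← hθ']
    exact congrArg (fun z ↦ P.p z y) (nat_apply θ' v.op x).symm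

lemma IsCodense.extend {F : A ⥤ B} (h : IsCodense F) {X X' : Bᵒᵖ ⥤ Type w} {Y' : B ⥤ Type w}
    (P : ConjPair X' Y') (φ : ∀ a : A, (X' ⟶ yoneda.obj (F.obj a)) → (X ⟶ yoneda.obj (F.obj a)))
    (hφ : ∀ {a a' : A} (f : a ⟶ a') (ξ : X' ⟶ yoneda.obj (F.obj a)),
      φ a' (ξ ≫ yoneda.map (F.map f)) = φ a ξ ≫ yoneda.map (F.map f)) :
    ∃! θ : X ⟶ X', ∀ (a : A) (ξ : X' ⟶ yoneda.obj (F.obj a)), θ ≫ ξ = φ a ξ := by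
  have hP : ∀ {b b' : B} (g : b ⟶ b') (y : Y'.obj b),
      P.toRight (Y'.map g y) = P.toRight y ≫ yoneda.map g := by
    intro b b' g y
    ext a x
    exact P.p_right g x y
  choose m hm hu using fun (b b' : B) (x : X.obj (op b)) (y : Y'.obj b') ↦
    h.existsUnique (b := b) (b' := b')
      (fun a v ↦ (φ a (P.toRight (Y'.map v y))).app (op b) x) (fun a a' f v ↦ by
      rw [Functor.map_comp_apply, hP, hφ]
      rfl)
  obtain ⟨θ, hθ⟩ := P.exists_hom (X := X) (fun {b b'} x y ↦ m b b' x y)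
    (fun {b c b'} f x y ↦ (hu c b' _ y _ fun a v ↦ by
      rw [Category.assoc, hm]
      exact (nat_apply (φ a (P.toRight (Y'.map v y))) f.op x).symm).symm)
    (fun {b b' c} g x y ↦ (hu b c x _ _ fun a v ↦ by
      have := hm b b' x y a (g ≫ v)
      simpa using this).symm)
  refine ⟨θ, fun a ξ ↦ ?_, fun θ' hθ' ↦ ?_⟩
  · obtain ⟨y, rfl⟩ := (P.bijective_toRight _).surjective ξ
    ext b x
    refine (hθ (b := b.unop) x y).trans ?_
    have := hm _ _ x y a (𝟙 _)
    simpa using this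
  · ext b x
    refine P.hom_ext (b := b.unop) fun b' y ↦ ?_
    refine Eq.trans ?_ (hθ (b := b.unop) x y).symm
    refine hu _ _ x y _ fun a v ↦ ?_
    rw [← P.p_right, ← hθ']
    rfl

/-- If `F : A ⥤ B` is small-adequate, so is its composite with `J : B ⥤ R(B)`. -/
lemma IsSmallAdequate.comp_yonedaR {F : A ⥤ B} (h : IsSmallAdequate F) :
    IsSmallAdequate (F ⋙ yonedaR B) where
  full := have := h.full; inferInstance
  faithful := have := h.faithful; inferInstance
  dense := isDense_of_existsUnique fun {Z Z'} ψ hψ ↦ by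
    obtain ⟨Y', -, ⟨P⟩⟩ := (isReflexive_inclR Z').exists_conjPair
    obtain ⟨θ, hθ, hu⟩ := h.dense.extend (X := (inclR B).obj Z) P
      (fun a x ↦ yonedaREquiv _ Z' (ψ a ((yonedaREquiv _ Z).symm x)))
      (fun {a a'} f x ↦ by
        rw [← yonedaREquiv_map_comp]
        congr 1
        refine Eq.trans ?_ (hψ _ _ f _)
        congr 1
        rw [Equiv.symm_apply_eq]
        refine Eq.trans ?_ (yonedaREquiv_map_comp (F.map f) _).symm
        rw [Equiv.apply_symm_apply])
    refine ⟨(inclR B).preimage θ, fun a v ↦ (yonedaREquiv _ Z').injective ?_, fun m hm ↦ ?_⟩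
    · refine (yonedaREquiv_comp _ _).trans ?_
      rw [(inclR B).map_preimage, hθ, Equiv.symm_apply_apply]
    · refine (inclR B).map_injective ?_
      rw [(inclR B).map_preimage]
      refine hu _ fun a x ↦ ?_
      rw [← hm, yonedaREquiv_comp, Equiv.apply_symm_apply]
  codense := isCodense_of_existsUnique fun {Z Z'} ψ hψ ↦ by
    obtain ⟨Y', -, ⟨P⟩⟩ := (isReflexive_inclR Z').exists_conjPair
    obtain ⟨θ, hθ, hu⟩ := h.codense.extend (X := (inclR B).obj Z) P
      (fun a ξ ↦ homYonedaREquiv Z _ (ψ a ((homYonedaREquiv Z' _).symm ξ)))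
      (fun {a a'} f ξ ↦ by
        rw [← homYonedaREquiv_comp_map]
        congr 1
        refine Eq.trans ?_ (hψ _ _ f _)
        congr 1
        rw [Equiv.symm_apply_eq]
        refine Eq.trans ?_ (homYonedaREquiv_comp_map _ (F.map f)).symm
        rw [Equiv.apply_symm_apply])
    refine ⟨(inclR B).preimage θ, fun a v ↦ (homYonedaREquiv Z _).injective ?_, fun m hm ↦ ?_⟩
    · refine (homYonedaREquiv_comp _ _).trans ?_
      rw [(inclR B).map_preimage, hθ, Equiv.symm_apply_apply]
    · refine (inclR B).map_injective ?_
      rw [(inclR B).map_preimage]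
      refine hu _ fun a ξ ↦ ?_
      rw [← hm, homYonedaREquiv_comp, Equiv.apply_symm_apply]
  representablySmall Z := by
    have := (isReflexive_inclR Z).choose
    have : IsSmall (F.op ⋙ (inclR B).obj Z) := IsSmall.comp F.op (fun d ↦
      @IsSmall.of_iso _ _ _ _
        (NatIso.ofComponents (fun a ↦ (opEquiv d.unop (op (F.obj a.unop))).toIso.symm) :
          (nerve F).obj d.unop.unop ≅ F.op ⋙ coyoneda.obj d) (h.representablySmall _)) _
    exact IsSmall.of_iso (NatIso.ofComponents
      (fun a ↦ (yonedaREquiv (F.obj a.unop) Z).symm.toIso)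
      (fun {a a'} f ↦ ConcreteCategory.hom_ext _ _ fun x ↦ by
        apply (yonedaREquiv (F.obj a'.unop) Z).injective
        refine Eq.trans ?_ (yonedaREquiv_map_comp (F.map f.unop) _).symm
        exact ((yonedaREquiv _ Z).apply_symm_apply _).trans
          (congrArg _ ((yonedaREquiv _ Z).apply_symm_apply x).symm)) :
      F.op ⋙ (inclR B).obj Z ≅ (nerve (F ⋙ yonedaR B)).obj Z)
  corepresentablySmall Z := by
    obtain ⟨Y, _, ⟨P⟩⟩ := (isReflexive_inclR Z).exists_conjPair
    have : IsSmall (F ⋙ Y) := IsSmall.comp F (fun d ↦ h.corepresentablySmall d.unop) _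
    let e : ∀ b, Y.obj b ≃ (Z ⟶ (yonedaR B).obj b) := fun b ↦
      (Equiv.ofBijective _ (P.bijective_toRight b)).trans (homYonedaREquiv Z b).symm
    have he : ∀ b y, homYonedaREquiv Z b (e b y) = P.toRight y := fun b y ↦
      (homYonedaREquiv Z b).apply_symm_apply _
    exact IsSmall.of_iso (NatIso.ofComponents (fun a ↦ (e (F.obj a)).toIso)
      (fun {a a'} f ↦ ConcreteCategory.hom_ext _ _ fun y ↦ by
        apply (homYonedaREquiv Z (F.obj a')).injective
        refine (he _ _).trans ?_
        refine Eq.trans ?_ (homYonedaREquiv_comp_map _ (F.map f)).symm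
        refine Eq.trans ?_ (congrArg (· ≫ yoneda.map (F.map f)) (he _ y).symm)
        ext b x
        exact P.p_right (F.map f) x y) :
      F ⋙ Y ≅ ((conerve (F ⋙ yonedaR B)).obj Z).unop)

/-- For small-adequate `F : A ⥤ B`, the induced functor `R(F) = N_{J ∘ F} : R(B) ⥤ R(A)`. -/
noncomputable def mapR (F : A ⥤ B) (h : IsSmallAdequate F) :
    ReflexiveCompletion B ⥤ ReflexiveCompletion A :=
  nerveR (F ⋙ yonedaR B) h.comp_yonedaR

end Functors

end Isbell

-- The functor underlying `R(F) Z` is the restriction of `Z` along `F`, by the Yoneda lemma in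
-- `R(B)`. Since `R(F)` is by definition the nerve of the dense functor `J_B ∘ F`, it is full and
-- faithful with no further hypothesis. Only essential surjectivity is at stake.
--
-- Suppose `N_F` is small-adequate. Then `N_{N_F}` sends a reflexive `Z` to `R(A)(N_F -, Z)`.
-- Restricting this along `F` gives `R(A)(N_F F -, Z)`. As `F` is full and faithful, `N_F ∘ F ≅
-- J_A`, so by Yoneda the restriction is `Z` again. Hence `R(F) ∘ N_{N_F} ≅ 1` (`nerveRCompMapR`),
-- and `R(F)` is an equivalence. The other composite is then obtained by cancelling the fully
-- faithful `R(F)`.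
--
-- Every equivalence is small-adequate (`isSmallAdequate_of_isEquivalence`), which gives 3 → 2. For
-- 2 → 1, restrict `R(F)` along Yoneda: `N_F ≅ R(F) ∘ J_B` (`yonedaRCompMapR`). Here `J_B` is
-- small-adequate, and small-adequate functors compose (`IsSmallAdequate.comp`). Composition is the
-- substantial point: a transformation given only on the image of `F` must be extended to all of
-- `B`, and this is possible because the target belongs to a conjugate pair.

universe u₃

namespace Isbell

attribute [local instance 10000] CategoryStruct.toQuiver

variable {A : Type u₁} [Category.{w} A] {B : Type u₂} [Category.{w} B]
  {C : Type u₃} [Category.{w} C]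

/-! ### Invariance under isomorphism, and equivalences -/

/-- The nerve functor depends functorially on `F` up to isomorphism. -/
def nerveCongr {F G : A ⥤ B} (e : F ≅ G) : nerve F ≅ nerve G :=
  Functor.isoWhiskerLeft yoneda
    ((Functor.whiskeringLeft Aᵒᵖ Bᵒᵖ (Type w)).mapIso (NatIso.op e.symm))

/-- The conerve functor depends functorially on `F` up to isomorphism. -/
def conerveCongr {F G : A ⥤ B} (e : F ≅ G) : conerve F ≅ conerve G :=
  NatIso.ofComponents
    -- The conerve takes values in an opposite category and `Iso.op` reverses direction, so it is
    -- the inverse of `e` that is whiskered.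
    (fun b ↦ (Functor.isoWhiskerRight e.symm (coyoneda.obj (op b))).op)
    fun {b b'} f ↦ by
      apply Quiver.Hom.unop_inj
      ext a x
      exact (Category.assoc f x (e.inv.app a)).symm

/-- Each clause transports along the induced isomorphisms of nerves and conerves. This is needed
because `N_F` agrees with `R(F) ∘ J_B` only up to isomorphism. -/
lemma IsSmallAdequate.of_iso {F G : A ⥤ B} (h : IsSmallAdequate F) (e : F ≅ G) :
    IsSmallAdequate G where
  full := have := h.full; Functor.Full.of_iso e
  faithful := have := h.faithful; Functor.Faithful.of_iso e
  dense :=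
    { full := have := h.dense.full; Functor.Full.of_iso (nerveCongr e)
      faithful := have := h.dense.faithful; Functor.Faithful.of_iso (nerveCongr e) }
  representablySmall b :=
    have := h.representablySmall b
    IsSmall.of_iso ((nerveCongr e).app b)
  codense :=
    { full := have := h.codense.full; Functor.Full.of_iso (conerveCongr e)
      faithful := have := h.codense.faithful; Functor.Faithful.of_iso (conerveCongr e) }
  corepresentablySmall b :=
    have := h.corepresentablySmall b
    IsSmall.of_iso ((conerveCongr e).app b).unop.symm

/-- Every object of `B` is isomorphic to some `G a`. At such an object (co)density is the Yoneda
argument of evaluating at one universal arrow, and the (co)nerve is representable, hence small. -/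
lemma isSmallAdequate_of_isEquivalence (G : A ⥤ B) [G.IsEquivalence] : IsSmallAdequate G where
  full := inferInstance
  faithful := inferInstance
  dense := isDense_of_existsUnique fun {b b'} ψ hψ ↦ by
    let i := G.objObjPreimageIso b
    -- Every `v : G a ⟶ b` factors as `G.map _ ≫ i.hom` by fullness, so naturality determines `ψ`
    -- from its value at `i.hom`. The codense case is dual.
    refine ⟨i.inv ≫ ψ _ i.hom, fun a v ↦ ?_, fun m hm ↦ ?_⟩
    · have := hψ _ _ (G.preimage (v ≫ i.inv)) i.hom
      rw [G.map_preimage, Category.assoc, Category.assoc, i.inv_hom_id, Category.comp_id] at this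
      exact this.symm
    · rw [← hm, Iso.inv_hom_id_assoc]
  codense := isCodense_of_existsUnique fun {b b'} ψ hψ ↦ by
    let i := G.objObjPreimageIso b'
    refine ⟨ψ _ i.inv ≫ i.hom, fun a v ↦ ?_, fun m hm ↦ ?_⟩
    · have := hψ _ _ (G.preimage (i.hom ≫ v)) i.inv
      rw [G.map_preimage, i.inv_hom_id_assoc] at this
      rw [this, Category.assoc]
    · rw [← hm, Category.assoc, Iso.inv_hom_id, Category.comp_id]
  representablySmall b :=
    have := isSmall_yoneda (G.objPreimage b)
    IsSmall.of_iso (NatIso.ofComponents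
      (fun a ↦ ((Functor.FullyFaithful.ofFullyFaithful G).homEquiv.trans
        (G.objObjPreimageIso b).homToEquiv).toIso)
      fun {a a'} f ↦ ConcreteCategory.hom_ext _ _ fun v ↦ by
        change G.map (f.unop ≫ v) ≫ _ = G.map f.unop ≫ G.map v ≫ _
        rw [G.map_comp, Category.assoc] : yoneda.obj (G.objPreimage b) ≅ (nerve G).obj b)
  corepresentablySmall b :=
    have := isSmall_coyoneda (op (G.objPreimage b))
    IsSmall.of_iso (NatIso.ofComponents
      (fun a ↦ ((Functor.FullyFaithful.ofFullyFaithful G).homEquiv.trans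
        (G.objObjPreimageIso b).homFromEquiv).toIso)
      fun {a a'} f ↦ ConcreteCategory.hom_ext _ _ fun v ↦ by
        change _ ≫ G.map (v ≫ f) = (_ ≫ G.map v) ≫ G.map f
        rw [G.map_comp, Category.assoc] :
      coyoneda.obj (op (G.objPreimage b)) ≅ ((conerve G).obj b).unop)

/-! ### Composition of small-adequate functors -/

/-- If `G : B ⥤ C` is small-adequate, maps into `G b` are transformations from the nerve
to `B(-, b)`. -/
noncomputable def IsSmallAdequate.homEquivNerve {G : B ⥤ C} (h : IsSmallAdequate G) (c : C)
    (b : B) : (c ⟶ G.obj b) ≃ ((nerve G).obj c ⟶ yoneda.obj b) :=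
  Equiv.ofBijective (fun v ↦ (h.conjPair c).toRight (b := b) v)
    ((h.conjPair c).bijective_toRight b)

lemma IsSmallAdequate.homEquivNerve_comp_map {G : B ⥤ C} (h : IsSmallAdequate G) {c : C}
    {b b' : B} (v : c ⟶ G.obj b) (g : b ⟶ b') :
    h.homEquivNerve c b' (v ≫ G.map g) = h.homEquivNerve c b v ≫ yoneda.map g := by
  ext a x
  exact (h.conjPair c).p_right g x v

/-- Both sides send `x` to the `G`-preimage of the composite of `x`, `m` and `v`, so this is
associativity. It turns a condition on arrows out of `c'` into one on transformations of nerves. -/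
lemma IsSmallAdequate.homEquivNerve_comp {G : B ⥤ C} (h : IsSmallAdequate G) {c c' : C}
    {b : B} (m : c ⟶ c') (v : c' ⟶ G.obj b) :
    h.homEquivNerve c b (m ≫ v) = (nerve G).map m ≫ h.homEquivNerve c' b v := by
  have := h.full
  have := h.faithful
  ext a x
  have hx : ∀ x : G.obj a.unop ⟶ c, G.preimage (x ≫ m ≫ v) = G.preimage ((x ≫ m) ≫ v) :=
    fun x ↦ by rw [Category.assoc]
  exact hx x

/-- Small-adequate functors compose. -/
lemma IsSmallAdequate.comp {F : A ⥤ B} {G : B ⥤ C} (hF : IsSmallAdequate F)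
    (hG : IsSmallAdequate G) : IsSmallAdequate (F ⋙ G) where
  full := have := hF.full; have := hG.full; inferInstance
  faithful := have := hF.faithful; have := hG.faithful; inferInstance
  dense := isDense_of_existsUnique fun {c c'} ψ hψ ↦ by
    have := hG.dense.full
    have := hG.dense.faithful
    -- `ψ` is a transformation between the nerves of `c` and `c'` defined only at the objects `F a`.
    -- Density of `F` extends it to `B`, and density of `G` then turns the extension into an arrow
    -- `c ⟶ c'`.
    obtain ⟨θ, hθ, hu⟩ := hF.dense.extend (X := (nerve G).obj c) (hG.conjPair c')
      (fun a v ↦ ψ a v) (fun {a a'} f v ↦ hψ _ _ f v)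
    refine ⟨(nerve G).preimage θ, fun a v ↦ ?_, fun m hm ↦ (nerve G).map_injective ?_⟩
    · refine Eq.trans ?_ (hθ a v)
      exact ConcreteCategory.congr_hom (CC := fun X ↦ X)
        (NatTrans.congr_app ((nerve G).map_preimage θ) (op (F.obj a))) v
    · rw [(nerve G).map_preimage]
      exact hu _ hm
  codense := isCodense_of_existsUnique fun {c c'} ψ hψ ↦ by
    have := hG.dense.full
    have := hG.dense.faithful
    -- Arrows `c ⟶ G (F a)` are read as transformations from the nerve of `c` to `B(-, F a)`.
    -- Codensity of `F` thus applies to nerves, and the arrow `c ⟶ c'` is again recovered from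
    -- density of `G`; codensity of `G` enters through the conjugate pair.
    obtain ⟨θ, hθ, hu⟩ := hF.codense.extend (X := (nerve G).obj c) (hG.conjPair c')
      (fun a ξ ↦ hG.homEquivNerve c _ (ψ a ((hG.homEquivNerve c' _).symm ξ)))
      (fun {a a'} f ξ ↦ by
        rw [← hG.homEquivNerve_comp_map]
        congr 1
        refine Eq.trans ?_ (hψ _ _ f _)
        congr 1
        rw [Equiv.symm_apply_eq]
        refine Eq.trans ?_ (hG.homEquivNerve_comp_map _ (F.map f)).symm
        rw [Equiv.apply_symm_apply])
    refine ⟨(nerve G).preimage θ, fun a v ↦ (hG.homEquivNerve c _).injective ?_,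
      fun m hm ↦ (nerve G).map_injective ?_⟩
    · refine (hG.homEquivNerve_comp _ _).trans ?_
      rw [(nerve G).map_preimage, hθ, Equiv.symm_apply_apply]
    · rw [(nerve G).map_preimage]
      refine hu _ fun a ξ ↦ ?_
      rw [← hm, hG.homEquivNerve_comp, Equiv.apply_symm_apply]
  representablySmall c := by
    have := hG.representablySmall c
    exact IsSmall.comp F.op (fun d ↦
      @IsSmall.of_iso _ _ _ _
        (NatIso.ofComponents (fun a ↦ (opEquiv d.unop (op (F.obj a.unop))).toIso.symm) :
          (nerve F).obj d.unop.unop ≅ F.op ⋙ coyoneda.obj d) (hF.representablySmall _))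
      ((nerve G).obj c)
  corepresentablySmall c := by
    have := hG.corepresentablySmall c
    exact IsSmall.comp F (fun d ↦ hF.corepresentablySmall d.unop) ((conerve G).obj c).unop

/-- The Yoneda embedding into the reflexive completion is small-adequate. -/
lemma isSmallAdequate_yonedaR (A : Type u₁) [Category.{w} A] : IsSmallAdequate (yonedaR A) :=
  -- `J` is `J ∘ 1`, and the identity is an equivalence.
  (isSmallAdequate_of_isEquivalence (𝟭 A)).comp_yonedaR.of_iso (yonedaR A).leftUnitor

/-! ### Comparing `N_F`, `R(F)` and the Yoneda embeddings -/

/-- The functor underlying `N_F b` is `B(F-, b)`. -/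
noncomputable def nerveRCompInclR (F : A ⥤ B) (h : IsSmallAdequate F) :
    nerveR F h ⋙ inclR A ≅ nerve F :=
  -- `nerveR` ends with the equivalence that shrinks hom-sets and `inclR` begins with its inverse;
  -- the two cancel.
  Functor.isoWhiskerRight (Functor.isoWhiskerLeft
    (ObjectProperty.lift _ (nerve F) h.isReflexive_nerve)
    (ShrinkHoms.equivalence _).unitIso.symm) (ObjectProperty.ι _)

/-- The reflexive functor underlying `J a` is `A(-, a)`. -/
noncomputable def yonedaRCompInclR (A : Type u₁) [Category.{w} A] :
    yonedaR A ⋙ inclR A ≅ yoneda :=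
  NatIso.ofComponents (fun _ ↦ Iso.refl _) fun f ↦ by
    refine (Category.comp_id _).trans (Eq.trans ?_ (Category.id_comp _).symm)
    exact inclR_map_yonedaR f

/-- The nerve of `J ∘ F` is restriction along `F`. -/
noncomputable def nerveCompYonedaR (F : A ⥤ B) :
    nerve (F ⋙ yonedaR B) ≅ inclR B ⋙ (Functor.whiskeringLeft _ _ (Type w)).obj F.op :=
  NatIso.ofComponents
    (fun Z ↦ NatIso.ofComponents (fun a ↦ (yonedaREquiv (F.obj a.unop) Z).toIso)
      fun {a a'} f ↦ ConcreteCategory.hom_ext _ _ fun g ↦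
        yonedaREquiv_map_comp (F.map f.unop) g)
    fun {Z Z'} θ ↦ by
      ext a g
      exact yonedaREquiv_comp g θ

/-- The functor underlying `R(F) Z` is the restriction of `Z` along `F`. -/
noncomputable def mapRCompInclR (F : A ⥤ B) (h : IsSmallAdequate F) :
    mapR F h ⋙ inclR A ≅ inclR B ⋙ (Functor.whiskeringLeft _ _ (Type w)).obj F.op :=
  nerveRCompInclR _ _ ≪≫ nerveCompYonedaR F

/-- `R(F)` restricts to `N_F` along the Yoneda embedding. -/
noncomputable def yonedaRCompMapR (F : A ⥤ B) (h : IsSmallAdequate F) :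
    yonedaR B ⋙ mapR F h ≅ nerveR F h :=
  -- It suffices to compare underlying functors: the restriction of `B(-, b)` along `F` is `B(F-,
  -- b)`.
  Functor.fullyFaithfulCancelRight (inclR A) <|
    Functor.associator _ _ _ ≪≫ Functor.isoWhiskerLeft (yonedaR B) (mapRCompInclR F h) ≪≫
      (Functor.associator _ _ _).symm ≪≫
      Functor.isoWhiskerRight (yonedaRCompInclR B) _ ≪≫ (nerveRCompInclR F h).symm

/-- If `F` is fully faithful, then `A(-, a)` is isomorphic to `B(F-, F a)`. -/
noncomputable def compNerve (F : A ⥤ B) [F.Full] [F.Faithful] : F ⋙ nerve F ≅ yoneda :=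
  Iso.symm <| NatIso.ofComponents
    (fun a ↦ NatIso.ofComponents
      (fun a' ↦ ((Functor.FullyFaithful.ofFullyFaithful F).homEquiv (X := a'.unop)).toIso)
      fun f ↦ ConcreteCategory.hom_ext _ _ fun g ↦ F.map_comp f.unop g)
    fun f ↦ by
      ext a g
      exact F.map_comp g f

/-- `N_F` extends the Yoneda embedding along `F`. -/
noncomputable def compNerveR (F : A ⥤ B) (h : IsSmallAdequate F) :
    F ⋙ nerveR F h ≅ yonedaR A :=
  have := h.full
  have := h.faithful
  Functor.fullyFaithfulCancelRight (inclR A) <|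
    Functor.associator _ _ _ ≪≫ Functor.isoWhiskerLeft F (nerveRCompInclR F h) ≪≫
      compNerve F ≪≫ (yonedaRCompInclR A).symm

/-- `R(F) ∘ N_{N_F}` is isomorphic to the identity. -/
noncomputable def nerveRCompMapR (F : A ⥤ B) (hF : IsSmallAdequate F)
    (h : IsSmallAdequate (nerveR F hF)) :
    nerveR (nerveR F hF) h ⋙ mapR F hF ≅ 𝟭 (ReflexiveCompletion A) :=
  Functor.fullyFaithfulCancelRight (inclR A) <|
    Functor.associator _ _ _ ≪≫ Functor.isoWhiskerLeft _ (mapRCompInclR F hF) ≪≫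
      (Functor.associator _ _ _).symm ≪≫
      Functor.isoWhiskerRight (nerveRCompInclR (nerveR F hF) h)
        ((Functor.whiskeringLeft _ _ (Type w)).obj F.op) ≪≫
      -- Restricting the nerve of `N_F` along `F` gives, by definition, the nerve of `N_F ∘ F`,
      -- which is replaced by that of `J_A`. Writing `J_A` as `J_A ∘ 1` lets the Yoneda comparison
      -- finish, since restriction along the identity does nothing.
      nerveCongr (compNerveR F hF) ≪≫ nerveCongr (yonedaR A).leftUnitor.symm ≪≫
      nerveCompYonedaR (𝟭 A)

/-! ### The equivalence of reflexive completions -/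

/-- `N_F` is the nerve of a dense functor with its codomain cut down to a full subcategory. Applied
to `J_B ∘ F`, this and the faithful counterpart make `R(F)` full and faithful unconditionally. -/
lemma IsSmallAdequate.full_nerveR {F : A ⥤ B} (h : IsSmallAdequate F) : (nerveR F h).Full :=
  have := h.dense.full
  Functor.Full.comp (ObjectProperty.lift _ (nerve F) h.isReflexive_nerve)
    (ShrinkHoms.functor.{w} _)

lemma IsSmallAdequate.faithful_nerveR {F : A ⥤ B} (h : IsSmallAdequate F) :
    (nerveR F h).Faithful :=
  have := h.dense.faithful
  Functor.Faithful.comp (ObjectProperty.lift _ (nerve F) h.isReflexive_nerve)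
    (ShrinkHoms.functor.{w} _)

/-- Small-adequacy of `N_F` serves only essential surjectivity: it makes `N_{N_F} Z` available as a
preimage of `Z`. -/
lemma isEquivalence_mapR (F : A ⥤ B) (hF : IsSmallAdequate F)
    (h : IsSmallAdequate (nerveR F hF)) : (mapR F hF).IsEquivalence where
  full := hF.comp_yonedaR.full_nerveR
  faithful := hF.comp_yonedaR.faithful_nerveR
  essSurj := ⟨fun Z ↦ ⟨_, ⟨(nerveRCompMapR F hF h).app Z⟩⟩⟩

end Isbell

theorem theorem9p3 {A : Type u₁} [Category.{w} A] {B : Type u₂} [Category.{w} B]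
    (F : A ⥤ B) (hF : Isbell.IsSmallAdequate F) :
    List.TFAE [
      Isbell.IsSmallAdequate (Isbell.nerveR F hF),
      Isbell.IsSmallAdequate (Isbell.mapR F hF),
      (Isbell.mapR F hF).IsEquivalence] ∧
    ∀ h : Isbell.IsSmallAdequate (Isbell.nerveR F hF),
      Nonempty (Isbell.nerveR (Isbell.nerveR F hF) h ⋙ Isbell.mapR F hF ≅
        𝟭 (Isbell.ReflexiveCompletion A)) ∧
      Nonempty (Isbell.mapR F hF ⋙ Isbell.nerveR (Isbell.nerveR F hF) h ≅
        𝟭 (Isbell.ReflexiveCompletion B)) := by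
  refine ⟨?_, fun h ↦ ⟨⟨Isbell.nerveRCompMapR F hF h⟩, ?_⟩⟩
  · tfae_have 1 → 3 := Isbell.isEquivalence_mapR F hF
    tfae_have 3 → 2 := fun _ ↦ Isbell.isSmallAdequate_of_isEquivalence _
    tfae_have 2 → 1 := fun h ↦
      -- `N_F ≅ R(F) ∘ J_B` is a composite of small-adequate functors.
      ((Isbell.isSmallAdequate_yonedaR B).comp h).of_iso (Isbell.yonedaRCompMapR F hF)
    tfae_finish
  · have := Isbell.isEquivalence_mapR F hF h
    -- After composing with the fully faithful `R(F)`, the claim becomes `R(F) ∘ N_{N_F} ∘ R(F) ≅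
    -- R(F)`, which follows from the first isomorphism.
    exact ⟨Functor.fullyFaithfulCancelRight (Isbell.mapR F hF) <|
      Functor.associator _ _ _ ≪≫
        Functor.isoWhiskerLeft (Isbell.mapR F hF) (Isbell.nerveRCompMapR F hF h) ≪≫
        Functor.rightUnitor _ ≪≫ (Functor.leftUnitor _).symm⟩
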